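/- Let $d\ge 1$ be an integer, $\eta>0$, and $\mathbb T^d=\mathbb R^d/\mathbb Z^d$. Write $k=\lfloor\eta\rfloor$ and let $\mathcal H^\eta_1=\mathcal H^\eta_1(\mathbb T^d,\mathbb R)$ be the set of functions $f\in C^{k}(\mathbb T^d,\mathbb R)$ with $$\sum_{|\nu|\le k}\|\partial^\nu f\|_\infty+\sum_{|\nu|=k}\ \sup_{x\ne y}\frac{|\partial^\nu f(x)-\partial^\nu f(y)|}{\min\{1,\|x-y\|^{\eta-k}\}}\le 1 ,$$ where $\nu\in\mathbb N_0^d$ runs over multi-indices and $\|x-y\|$ is the periodised Euclidean distance. For $\mathcal F\subset L^2(\mathbb T^d,\mathbb R)$ and $\theta>0$ let $$|\mathcal F_\theta|=\min\big\{|A| \,:\, A\subset L^2(\mathbb T^d,\mathbb R),\ \forall f\in\mathcal F\ \exists a\in A,\ \|f-a\|_\infty\le\theta\big\}\in\mathbb N_0\cup\{\infty\}$$ be the $\theta$-covering number of $\mathcal F$ in the (essential) sup-norm, with $\log\infty=\infty$. Then there is a constant $C>0$ depending only on $d$ and $\eta$ such that for every $\varepsilon\in(0,3/4]$, every $\mathcal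 F\subset L^2(\mathbb T^d,\mathbb R)$ satisfying $$\sup_{f\in\mathcal H^\eta_1}\ \inf_{g\in\mathcal F}\|f-g\|_\infty\le\varepsilon ,$$ and every $\theta\in(0,\varepsilon/3)$, $$\log|\mathcal F_\theta|\ \ge\ C\,\varepsilon^{-d/\eta}.$$ -/

import Mathlib

open MeasureTheory
open scoped ENNReal

noncomputable section

/-- The periodic lift to `ℝ^d` of a function on the torus `𝕋^d = ℝ^d / ℤ^d`. -/
def torusLift {d : ℕ} (f : UnitAddTorus (Fin d) → ℝ) : EuclideanSpace ℝ (Fin d) → ℝ :=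
  fun x => f (fun i => (x i : UnitAddCircle))

/-- The partial derivative `∂_i g = ∂g/∂x_i` of a function `g` on `ℝ^d`. -/
def partialDeriv {d : ℕ} (i : Fin d) (g : EuclideanSpace ℝ (Fin d) → ℝ) :
    EuclideanSpace ℝ (Fin d) → ℝ :=
  fun x => lineDeriv ℝ g x (EuclideanSpace.single i (1 : ℝ))

/-- The mixed partial derivative `∂^ν g = ∂_1^{ν_1} ⋯ ∂_d^{ν_d} g` for a multi-index `ν`. -/
def multiDeriv {d : ℕ} (ν : Fin d → ℕ) (g : EuclideanSpace ℝ (Fin d) → ℝ) :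
    EuclideanSpace ℝ (Fin d) → ℝ :=
  (List.finRange d).foldr (fun i h => (partialDeriv i)^[ν i] h) g

/-- The Hölder seminorm `sup_{x ≠ y} |g x - g y| / min {1, ‖x - y‖ ^ s}`.

For a periodic `g` this is the seminorm of the corresponding function on the torus with respect to
the periodised Euclidean distance: that distance is the minimum of `‖x - y‖` over all lifts, and the
numerator depends only on the classes of `x` and `y`. -/
def holderSeminorm {d : ℕ} (s : ℝ) (g : EuclideanSpace ℝ (Fin d) → ℝ) : ℝ≥0∞ :=
  ⨆ (x : EuclideanSpace ℝ (Fin d)) (y : EuclideanSpace ℝ (Fin d)) (_ : x ≠ y),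
    ENNReal.ofReal (|g x - g y| / min 1 (‖x - y‖ ^ s))

/-- The Hölder norm of order `η` of a function on the torus: with `k = ⌊η⌋`,
`∑_{|ν| ≤ k} ‖∂^ν f‖_∞ + ∑_{|ν| = k} ‖∂^ν f‖_{η - k}`.
`Finset.piAntidiag Finset.univ j` is the set of all multi-indices `ν` with `|ν| = j`. -/
def torusHolderNorm {d : ℕ} (η : ℝ) (f : UnitAddTorus (Fin d) → ℝ) : ℝ≥0∞ :=
  (∑ j ∈ Finset.range (⌊η⌋₊ + 1), ∑ ν ∈ Finset.piAntidiag (Finset.univ : Finset (Fin d)) j,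
      ⨆ x, ENNReal.ofReal |multiDeriv ν (torusLift f) x|) +
    ∑ ν ∈ Finset.piAntidiag (Finset.univ : Finset (Fin d)) ⌊η⌋₊,
      holderSeminorm (η - ⌊η⌋₊) (multiDeriv ν (torusLift f))

/-- The ball `ℋ^η_K(𝕋^d, ℝ)` of radius `K` of the Hölder space. -/
def torusHolderBall (d : ℕ) (η K : ℝ) : Set (UnitAddTorus (Fin d) → ℝ) :=
  {f | ContDiff ℝ ⌊η⌋₊ (torusLift f) ∧ torusHolderNorm η f ≤ ENNReal.ofReal K}

/-- The (possibly infinite) sup-norm distance `‖f - g‖_∞` of two functions on the torus, as an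
essential supremum for the Lebesgue measure. -/
def supDist {d : ℕ} (f g : UnitAddTorus (Fin d) → ℝ) : ℝ≥0∞ :=
  eLpNorm (fun u => f u - g u) ∞ volume

/-- The space `L²(𝕋^d, ℝ)`. -/
abbrev TorusL2 (d : ℕ) : Type :=
  Lp ℝ 2 (volume : Measure (UnitAddTorus (Fin d)))

/-- The `θ`-covering number `|F_θ|` of a class `F ⊆ L²(𝕋^d, ℝ)` for the sup-norm: the least
cardinality of a set `A` (not necessarily contained in `F`) such that every element of `F` is within
`θ` of an element of `A`. It is `⊤` if there is no finite such set. -/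
def supCoveringNumber {d : ℕ} (F : Set (TorusL2 d)) (θ : ℝ) : ℕ∞ :=
  ⨅ (A : Set (TorusL2 d)) (_ : ∀ f ∈ F, ∃ a ∈ A, supDist f a ≤ ENNReal.ofReal θ), A.encard

end

/-! This is a packing argument. Place smooth bumps of height `8/3 * ε` in any selection of the `N ^
d` cells of the grid of mesh `1 / N`. Two selections give functions `8/3 * ε` apart, and all the
Hölder norms are at most a constant times `ε * N ^ η`, so `N` can be taken of order `ε ^ (-1/η)`.
Since `2ε + 2θ < 8/3 * ε`, one covering centre cannot serve two of the `2 ^ (N ^ d)` functions,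
whence the bound on the logarithm. When `ε` is too large for a single bump, the constants `±1`
replace the grid. The norm bound rests on `exists_gridSum_eventuallyEq`: near each point a sum of
bumps is a multiple of one translated bump. -/

open Filter Topology

/-- Euclidean space `ℝ^d`. -/
local notation "𝔼" d => EuclideanSpace ℝ (Fin d)

/-! ### Partial derivatives and dilations -/

theorem partialDeriv_comp_affine {d : ℕ} (i : Fin d) (c N : ℝ) (z : 𝔼 d) (g : (𝔼 d) → ℝ) :
    partialDeriv i (fun x => c * g (N • x - z)) =
      fun x => c * N * partialDeriv i g (N • x - z) := by
  funext x
  simp only [partialDeriv, lineDeriv]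
  have h : (fun t : ℝ => c * g (N • (x + t • EuclideanSpace.single i (1 : ℝ)) - z)) =
      fun t : ℝ => c * (fun s : ℝ =>
        g (N • x - z + s • EuclideanSpace.single i (1 : ℝ))) (N * t) := by
    funext t
    simp only [smul_add, smul_smul]
    congr 2
    abel
  rw [h, deriv_const_mul_field, deriv_comp_mul_left N (fun s : ℝ =>
    g (N • x - z + s • EuclideanSpace.single i (1 : ℝ))) 0]
  simp [mul_assoc]

theorem partialDeriv_congr_of_eventuallyEq {d : ℕ} (i : Fin d) {f g : (𝔼 d) → ℝ} {x : 𝔼 d}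
    (h : f =ᶠ[𝓝 x] g) : partialDeriv i f x = partialDeriv i g x :=
  h.lineDeriv_eq

theorem partialDeriv_const {d : ℕ} (i : Fin d) (c : ℝ) :
    partialDeriv i (fun _ : 𝔼 d => c) = fun _ => 0 := by
  funext x
  simp [partialDeriv, lineDeriv]

theorem partialDeriv_eq_fderiv {d : ℕ} (i : Fin d) {g : (𝔼 d) → ℝ} (hg : Differentiable ℝ g) :
    partialDeriv i g = fun x => fderiv ℝ g x (EuclideanSpace.single i (1 : ℝ)) := by
  funext x
  exact (hg x).lineDeriv_eq_fderiv

theorem multiDeriv_const {d : ℕ} (ν : Fin d → ℕ) (c : ℝ) :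
    multiDeriv ν (fun _ : 𝔼 d => c) = fun _ => if ν = 0 then c else 0 := by
  have hit : ∀ (i : Fin d) (n : ℕ) (c : ℝ), (partialDeriv i)^[n] (fun _ : 𝔼 d => c) =
      fun _ => if n = 0 then c else 0 := by
    intro i n
    induction n with
    | zero => intro c; simp
    | succ n ih =>
      intro c
      rw [Function.iterate_succ_apply, partialDeriv_const, ih]
      simp
  have hl : ∀ l : List (Fin d), l.foldr (fun i h => (partialDeriv i)^[ν i] h)
      (fun _ : 𝔼 d => c) = fun _ => if ∀ i ∈ l, ν i = 0 then c else 0 := by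
    intro l
    induction l with
    | nil => simp
    | cons i l ih =>
      rw [List.foldr_cons, ih, hit]
      funext _
      by_cases h1 : ν i = 0 <;> simp [h1]
  rw [multiDeriv, hl]
  simp [funext_iff]

theorem multiDeriv_comp_smul {d : ℕ} (ν : Fin d → ℕ) (c N : ℝ) (g : (𝔼 d) → ℝ) :
    multiDeriv ν (fun x => c * g (N • x)) =
      fun x => c * N ^ (∑ i, ν i) * multiDeriv ν g (N • x) := by
  have h1 : ∀ (i : Fin d) (c : ℝ) (g : (𝔼 d) → ℝ), partialDeriv i (fun x => c * g (N • x)) =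
      fun x => c * N * partialDeriv i g (N • x) := by
    intro i c g
    simpa using partialDeriv_comp_affine i c N 0 g
  have hit : ∀ (i : Fin d) (n : ℕ) (c : ℝ) (g : (𝔼 d) → ℝ),
      (partialDeriv i)^[n] (fun x => c * g (N • x)) =
        fun x => c * N ^ n * ((partialDeriv i)^[n] g) (N • x) := by
    intro i n
    induction n with
    | zero => intro c g; simp
    | succ n ih =>
      intro c g
      rw [Function.iterate_succ_apply, h1, ih, Function.iterate_succ_apply]
      funext x
      ring
  have hl : ∀ l : List (Fin d), l.foldr (fun i h => (partialDeriv i)^[ν i] h)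
      (fun x => c * g (N • x)) = fun x => c * N ^ (l.map ν).sum *
        (l.foldr (fun i h => (partialDeriv i)^[ν i] h) g) (N • x) := by
    intro l
    induction l with
    | nil => simp
    | cons i l ih =>
      rw [List.foldr_cons, ih, hit, List.foldr_cons]
      funext x
      simp only [List.map_cons, List.sum_cons]
      ring
  rw [multiDeriv, hl, Fin.sum_univ_def]
  rfl

/-! ### Bumps and sums of their integer translates -/

/-- Smooth functions supported in the cube `[1/4, 3/4]^d`. -/
structure IsCubeBump {d : ℕ} (φ : (𝔼 d) → ℝ) : Prop where
  contDiff : ∀ n : ℕ, ContDiff ℝ n φ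
  eq_zero : ∀ x i, x i ∉ Set.Icc (1 / 4 : ℝ) (3 / 4) → φ x = 0

namespace IsCubeBump

variable {d : ℕ} {φ : (𝔼 d) → ℝ}

theorem differentiable (h : IsCubeBump φ) : Differentiable ℝ φ :=
  (h.contDiff 1).differentiable (by norm_num)

protected theorem partialDeriv (h : IsCubeBump φ) (i : Fin d) : IsCubeBump (partialDeriv i φ) where
  contDiff n := by
    rw [partialDeriv_eq_fderiv i h.differentiable]
    exact ((h.contDiff (n + 1)).fderiv_right (by norm_cast)).clm_apply contDiff_const
  eq_zero x j hj := by
    have ho : IsOpen {y : 𝔼 d | y j ∉ Set.Icc (1 / 4 : ℝ) (3 / 4)} :=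
      (isClosed_Icc.preimage (by fun_prop : Continuous fun y : 𝔼 d => y j)).isOpen_compl
    have he : φ =ᶠ[𝓝 x] fun _ => 0 := by
      filter_upwards [ho.mem_nhds hj] with y hy using h.eq_zero y j hy
    rw [partialDeriv_congr_of_eventuallyEq i he, partialDeriv_const]

theorem iterate_partialDeriv (h : IsCubeBump φ) (i : Fin d) (n : ℕ) :
    IsCubeBump ((partialDeriv i)^[n] φ) := by
  induction n with
  | zero => exact h
  | succ n ih => rw [Function.iterate_succ_apply']; exact ih.partialDeriv i

theorem foldr_partialDeriv (h : IsCubeBump φ) (ν : Fin d → ℕ) (l : List (Fin d)) :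
    IsCubeBump (l.foldr (fun i h => (partialDeriv i)^[ν i] h) φ) := by
  induction l with
  | nil => exact h
  | cons i l ih => exact ih.iterate_partialDeriv i _

protected theorem multiDeriv (h : IsCubeBump φ) (ν : Fin d → ℕ) : IsCubeBump (multiDeriv ν φ) :=
  h.foldr_partialDeriv ν _

theorem hasCompactSupport (h : IsCubeBump φ) : HasCompactSupport φ := by
  refine HasCompactSupport.intro
    (K := (EuclideanSpace.equiv (Fin d) ℝ).toHomeomorph ⁻¹'
      Set.pi Set.univ fun _ => Set.Icc (1 / 4 : ℝ) (3 / 4)) ?_ ?_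
  · exact (Homeomorph.isCompact_preimage _).2 (isCompact_univ_pi fun _ => isCompact_Icc)
  · intro x hx
    simp only [Set.mem_preimage, Set.mem_univ_pi, not_forall] at hx
    obtain ⟨i, hi⟩ := hx
    exact h.eq_zero x i hi

/-- The factor `2` lets `M` bound a difference of two values as well. -/
theorem exists_bound (h : IsCubeBump φ) :
    ∃ M : ℝ, 0 ≤ M ∧ (∀ x, 2 * |φ x| ≤ M) ∧ ∀ x, ‖fderiv ℝ φ x‖ ≤ M := by
  obtain ⟨M₁, h₁⟩ := h.hasCompactSupport.exists_bound_of_continuous (h.contDiff 0).continuous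
  obtain ⟨M₂, h₂⟩ := (h.hasCompactSupport.fderiv ℝ).exists_bound_of_continuous
    ((h.contDiff 1).continuous_fderiv (by norm_num))
  refine ⟨max (2 * M₁) M₂, ?_, fun x => ?_, fun x => (h₂ x).trans (le_max_right _ _)⟩
  · exact (norm_nonneg _).trans ((h₂ 0).trans (le_max_right _ _))
  · have := h₁ x
    rw [Real.norm_eq_abs] at this
    exact le_trans (by linarith) (le_max_left _ _)

end IsCubeBump

/-- The superposition of the integer translates of `φ`, restricted to the unit cube, with the
coefficients `a`. -/
noncomputable def gridSum {d : ℕ} (a : (Fin d → ℤ) → ℝ) (φ : (𝔼 d) → ℝ) (y : 𝔼 d) : ℝ :=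
  a (fun i => ⌊y i⌋) * φ (WithLp.toLp 2 fun i => Int.fract (y i))

/-- The pair `c`, `z` is independent of `φ`, so one local description serves a bump and its
derivatives together. Inside a cell, `z` is its corner; on a wall, every bump vanishes nearby. -/
theorem exists_gridSum_eventuallyEq {d : ℕ} {a : (Fin d → ℤ) → ℝ} (ha : ∀ z, |a z| ≤ 1) (y : 𝔼 d) :
    ∃ (c : ℝ) (z : 𝔼 d), |c| ≤ 1 ∧
      ∀ φ : (𝔼 d) → ℝ, IsCubeBump φ → gridSum a φ =ᶠ[𝓝 y] fun x => c * φ (x - z) := by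
  by_cases hy : ∀ i, (⌊y i⌋ : ℝ) < y i
  · refine ⟨a fun i => ⌊y i⌋, WithLp.toLp 2 fun i => (⌊y i⌋ : ℝ), ha _, fun φ _ => ?_⟩
    have hev : ∀ᶠ x : 𝔼 d in 𝓝 y, ∀ i, x i ∈ Set.Ioo (⌊y i⌋ : ℝ) (⌊y i⌋ + 1) := by
      rw [eventually_all]
      intro i
      exact (by fun_prop : Continuous fun x : 𝔼 d => x i).continuousAt.eventually_mem
        (isOpen_Ioo.mem_nhds ⟨hy i, Int.lt_floor_add_one _⟩)
    filter_upwards [hev] with x hx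
    have hfl : ∀ i, ⌊x i⌋ = ⌊y i⌋ := fun i =>
      Int.floor_eq_iff.2 ⟨(hx i).1.le, (hx i).2⟩
    have hz : (WithLp.toLp 2 fun i => Int.fract (x i) : 𝔼 d) =
        x - WithLp.toLp 2 fun i => (⌊y i⌋ : ℝ) := by
      ext i
      simp [Int.fract, hfl]
    simp only [gridSum, hfl, hz]
  · push Not at hy
    obtain ⟨i, hi⟩ := hy
    refine ⟨0, 0, by simp, fun φ hφ => ?_⟩
    have hyi : y i = ⌊y i⌋ := le_antisymm hi (Int.floor_le _)
    have hev : ∀ᶠ x : 𝔼 d in 𝓝 y, x i ∈ Set.Ioo (⌊y i⌋ - 1 / 4 : ℝ) (⌊y i⌋ + 1 / 4) :=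
      (by fun_prop : Continuous fun x : 𝔼 d => x i).continuousAt.eventually_mem
        (isOpen_Ioo.mem_nhds ⟨by linarith, by linarith⟩)
    filter_upwards [hev] with x hx
    -- Within `1/4` of an integer the fractional part lies outside `[1/4, 3/4]`.
    have h0 : φ (WithLp.toLp 2 fun i => Int.fract (x i)) = 0 := by
      refine hφ.eq_zero _ i fun hmem => ?_
      have hm1 : 1 / 4 ≤ Int.fract (x i) := hmem.1
      have hm2 : Int.fract (x i) ≤ 3 / 4 := hmem.2
      rw [Int.fract] at hm1 hm2
      have e1 : (⌊x i⌋ : ℝ) < ⌊y i⌋ := by linarith [hx.2]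
      have e2 : (⌊y i⌋ : ℝ) < ⌊x i⌋ + 1 := by linarith [hx.1]
      norm_cast at e1 e2
      omega
    simp [gridSum, h0]

section gridSum

variable {d : ℕ} {a : (Fin d → ℤ) → ℝ} {φ : (𝔼 d) → ℝ}

theorem partialDeriv_gridSum (ha : ∀ z, |a z| ≤ 1) (hφ : IsCubeBump φ) (i : Fin d) :
    partialDeriv i (gridSum a φ) = gridSum a (partialDeriv i φ) := by
  funext y
  obtain ⟨c, z, -, h⟩ := exists_gridSum_eventuallyEq ha y
  rw [partialDeriv_congr_of_eventuallyEq i (h φ hφ), (h _ (hφ.partialDeriv i)).self_of_nhds]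
  have := congrFun (partialDeriv_comp_affine i c 1 z φ) y
  simpa using this

theorem multiDeriv_gridSum (ha : ∀ z, |a z| ≤ 1) (hφ : IsCubeBump φ) (ν : Fin d → ℕ) :
    multiDeriv ν (gridSum a φ) = gridSum a (multiDeriv ν φ) := by
  have hit : ∀ (i : Fin d) (n : ℕ) (ψ : (𝔼 d) → ℝ), IsCubeBump ψ →
      (partialDeriv i)^[n] (gridSum a ψ) = gridSum a ((partialDeriv i)^[n] ψ) := by
    intro i n
    induction n with
    | zero => intro ψ _; rfl
    | succ n ih =>
      intro ψ hψ
      rw [Function.iterate_succ_apply, partialDeriv_gridSum ha hψ, ih _ (hψ.partialDeriv i),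
        Function.iterate_succ_apply]
  have hl : ∀ l : List (Fin d), l.foldr (fun i h => (partialDeriv i)^[ν i] h) (gridSum a φ) =
      gridSum a (l.foldr (fun i h => (partialDeriv i)^[ν i] h) φ) := by
    intro l
    induction l with
    | nil => rfl
    | cons i l ih =>
      rw [List.foldr_cons, ih, hit _ _ _ (hφ.foldr_partialDeriv ν l), List.foldr_cons]
  exact hl _

theorem contDiff_gridSum (ha : ∀ z, |a z| ≤ 1) (hφ : IsCubeBump φ) (n : ℕ) :
    ContDiff ℝ n (gridSum a φ) := by
  rw [contDiff_iff_contDiffAt]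
  intro y
  obtain ⟨c, z, -, h⟩ := exists_gridSum_eventuallyEq ha y
  refine ContDiffAt.congr_of_eventuallyEq ?_ (h φ hφ)
  exact (contDiff_const.mul ((hφ.contDiff n).comp (contDiff_id.sub contDiff_const))).contDiffAt

theorem abs_gridSum_le (ha : ∀ z, |a z| ≤ 1) {M : ℝ} (hM : ∀ x, |φ x| ≤ M) (y : 𝔼 d) :
    |gridSum a φ y| ≤ M := by
  rw [gridSum, abs_mul]
  exact (mul_le_of_le_one_left (abs_nonneg _) (ha _)).trans (hM _)

/-- The local form bounds the derivative everywhere, so the mean value inequality covers points in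
different cells too. -/
theorem abs_gridSum_sub_le (ha : ∀ z, |a z| ≤ 1) (hφ : IsCubeBump φ) {M : ℝ}
    (hM : ∀ x, ‖fderiv ℝ φ x‖ ≤ M) (x y : 𝔼 d) :
    |gridSum a φ x - gridSum a φ y| ≤ M * ‖x - y‖ := by
  have hd : Differentiable ℝ (gridSum a φ) :=
    (contDiff_gridSum ha hφ 1).differentiable (by norm_num)
  refine convex_univ.norm_image_sub_le_of_norm_fderiv_le (𝕜 := ℝ) (fun w _ => hd w)
    (fun w _ => ?_) (Set.mem_univ y) (Set.mem_univ x)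
  obtain ⟨c, z, hc, h⟩ := exists_gridSum_eventuallyEq ha w
  have hz : DifferentiableAt ℝ (fun x => φ (x - z)) w :=
    (hφ.differentiable _).comp w (differentiableAt_id.sub_const z)
  rw [(h φ hφ).fderiv_eq, fderiv_const_mul hz c, fderiv_comp_sub, norm_smul]
  exact (mul_le_of_le_one_left (norm_nonneg _) hc).trans (hM _)

end gridSum

/-- A smooth bump supported in `[1/4, 3/4]^d` with the value `1` at the centre. -/
theorem exists_isCubeBump (d : ℕ) :
    ∃ φ : (𝔼 d) → ℝ, IsCubeBump φ ∧ φ (WithLp.toLp 2 fun _ => 1 / 2) = 1 := by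
  let b : ContDiffBump (WithLp.toLp 2 fun _ => 1 / 2 : 𝔼 d) :=
    ⟨1 / 8, 1 / 4, by norm_num, by norm_num⟩
  refine ⟨b, ⟨fun n => b.contDiff, fun x i hx => ?_⟩, b.one_of_mem_closedBall ?_⟩
  · by_contra hne
    have hx' : x ∈ Function.support b := hne
    rw [b.support_eq, Metric.mem_ball, dist_eq_norm] at hx'
    have hi := PiLp.norm_apply_le (x - WithLp.toLp 2 fun _ => 1 / 2 : 𝔼 d) i
    have h4 : b.rOut = 1 / 4 := rfl
    rw [h4] at hx'
    have h5 : |x i - 1 / 2| < 1 / 4 := lt_of_le_of_lt (by simpa using hi) hx'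
    rw [abs_lt] at h5
    exact hx ⟨by linarith, by linarith⟩
  · exact Metric.mem_closedBall_self (by show (0 : ℝ) ≤ 1 / 8; norm_num)

/-! ### The essential sup-distance and covering numbers -/

theorem continuous_of_continuous_torusLift {d : ℕ} {f : UnitAddTorus (Fin d) → ℝ}
    (hf : Continuous (torusLift f)) : Continuous f := by
  have hq : IsOpenQuotientMap (Pi.map fun (_ : Fin d) (t : ℝ) => (t : UnitAddCircle)) :=
    IsOpenQuotientMap.piMap fun _ => QuotientAddGroup.isOpenQuotientMap_mk
  rw [hq.isQuotientMap.continuous_iff]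
  exact hf.comp (PiLp.continuous_toLp 2 fun _ : Fin d => ℝ)

/-- By continuity, a violation at one point would persist on a nonempty open set, which has positive
measure. -/
theorem ofReal_abs_torusLift_sub_le_supDist {d : ℕ} {f g : UnitAddTorus (Fin d) → ℝ}
    (hf : Continuous (torusLift f)) (hg : Continuous (torusLift g)) (x : 𝔼 d) :
    ENNReal.ofReal |torusLift f x - torusLift g x| ≤ supDist f g := by
  by_contra! hlt
  have hw : Continuous fun u => ‖f u - g u‖ₑ :=
    ((continuous_of_continuous_torusLift hf).sub (continuous_of_continuous_torusLift hg)).enorm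
  have hae : ∀ᵐ u, ‖f u - g u‖ₑ ≤ supDist f g := by
    rw [supDist, eLpNorm_exponent_top]
    exact ae_le_eLpNormEssSup
  have ho : IsOpen {u | supDist f g < ‖f u - g u‖ₑ} := isOpen_lt continuous_const hw
  have hne : {u | supDist f g < ‖f u - g u‖ₑ}.Nonempty := by
    refine ⟨fun i => (x i : UnitAddCircle), ?_⟩
    rw [← Real.enorm_eq_ofReal_abs] at hlt
    exact hlt
  refine (ho.measure_pos volume hne).ne' ?_
  rw [ae_iff] at hae
  simpa using hae

theorem supDist_triangle {d : ℕ} (f g h : UnitAddTorus (Fin d) → ℝ) :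
    supDist f h ≤ supDist f g + supDist g h := by
  simp only [supDist, eLpNorm_exponent_top]
  refine le_trans (le_of_eq ?_) eLpNormEssSup_add_le
  congr 1
  funext u
  simp

theorem supDist_comm {d : ℕ} (f g : UnitAddTorus (Fin d) → ℝ) : supDist f g = supDist g f := by
  have h : (fun u => f u - g u) = -fun u => g u - f u := by
    funext u
    simp
  rw [supDist, supDist, h, eLpNorm_neg]

/-- A separated family in the Hölder ball bounds the covering numbers of every class that
approximates the ball from below. -/
theorem card_le_supCoveringNumber {d : ℕ} {H : Set (UnitAddTorus (Fin d) → ℝ)} {ι : Type*}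
    [Fintype ι] {f : ι → UnitAddTorus (Fin d) → ℝ} (hf : ∀ i, f i ∈ H) {ε θ r : ℝ}
    (hε : 0 < ε) (hθ : 0 < θ) (hr : 2 * ε + 2 * θ < r)
    (hsep : ∀ i j, i ≠ j → ENNReal.ofReal r ≤ supDist (f i) (f j)) {F : Set (TorusL2 d)}
    (hF : (⨆ f ∈ H, ⨅ g ∈ F, supDist f g) ≤ ENNReal.ofReal ε) :
    (Fintype.card ι : ℕ∞) ≤ supCoveringNumber F θ := by
  refine le_iInf₂ fun A hA => ?_
  -- The infimum over `F` need not be attained; `δ` is the slack for choosing a near-minimiser.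
  obtain ⟨δ, hδ, hδr⟩ : ∃ δ : ℝ, 0 < δ ∧ 2 * (ε + δ) + 2 * θ < r :=
    ⟨(r - 2 * ε - 2 * θ) / 4, by linarith, by linarith⟩
  have happ : ∀ i, ∃ a ∈ A, supDist (f i) a ≤ ENNReal.ofReal (ε + δ + θ) := by
    intro i
    have h1 : (⨅ g ∈ F, supDist (f i) g) < ENNReal.ofReal (ε + δ) :=
      ((le_iSup₂ (f := fun f _ => ⨅ g ∈ F, supDist f g) (f i) (hf i)).trans hF).trans_lt
        ((ENNReal.ofReal_lt_ofReal_iff (by linarith)).2 (by linarith))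
    simp only [iInf_lt_iff] at h1
    obtain ⟨g, hg, hfg⟩ := h1
    obtain ⟨a, ha, hga⟩ := hA g hg
    refine ⟨a, ha, (supDist_triangle _ g _).trans ?_⟩
    rw [ENNReal.ofReal_add (by linarith) hθ.le]
    exact add_le_add hfg.le hga
  choose a ha hfa using happ
  have hinj : Function.Injective a := by
    intro i j hij
    by_contra hne
    have h1 : supDist (f i) (f j) ≤ ENNReal.ofReal (ε + δ + θ) + ENNReal.ofReal (ε + δ + θ) := by
      refine (supDist_triangle _ (a i) _).trans (add_le_add (hfa i) ?_)
      rw [supDist_comm, hij]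
      exact hfa j
    rw [← ENNReal.ofReal_add (by linarith) (by linarith)] at h1
    have h2 := (ENNReal.ofReal_le_ofReal_iff (by linarith)).1 ((hsep i j hne).trans h1)
    linarith
  calc (Fintype.card ι : ℕ∞) = (Set.univ : Set ι).encard := by
        rw [Set.encard_univ, ENat.card_eq_coe_fintype_card]
    _ = (a '' Set.univ).encard := (hinj.encard_image _).symm
    _ ≤ A.encard := Set.encard_le_encard (by rintro _ ⟨i, -, rfl⟩; exact ha i)

theorem log_card_le_log_supCoveringNumber {n : ℕ} (hn : 0 < n) {m : ℕ∞} (h : (n : ℕ∞) ≤ m) :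
    ((Real.log n : ℝ) : EReal) ≤ ENNReal.log (m : ℝ≥0∞) := by
  rw [← ENNReal.log_ofReal_of_pos (by exact_mod_cast hn)]
  refine ENNReal.log_monotone ?_
  rw [ENNReal.ofReal_natCast]
  exact_mod_cast h

/-! ### Constant functions -/

theorem const_mem_torusHolderBall (d : ℕ) (η : ℝ) {c : ℝ} (hc : |c| ≤ 1) :
    (fun _ => c) ∈ torusHolderBall d η 1 := by
  have hl : torusLift (fun _ : UnitAddTorus (Fin d) => c) = fun _ => c := rfl
  refine ⟨by rw [hl]; exact contDiff_const, ?_⟩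
  rw [torusHolderNorm, hl]
  have h2 : ∀ ν : Fin d → ℕ,
      holderSeminorm (η - ⌊η⌋₊) (multiDeriv ν (fun _ : 𝔼 d => c)) = 0 := by
    intro ν
    simp [multiDeriv_const, holderSeminorm]
  simp only [h2, Finset.sum_const_zero, add_zero]
  rw [Finset.sum_eq_single 0]
  · rw [Finset.piAntidiag_zero, Finset.sum_singleton]
    simpa [multiDeriv_const] using ENNReal.ofReal_le_ofReal hc
  · intro j _ hj
    refine Finset.sum_eq_zero fun ν hν => ?_
    have hν0 : ν ≠ 0 := by
      rintro rfl
      simp only [Finset.mem_piAntidiag, Pi.zero_apply, Finset.sum_const_zero] at hν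
      exact hj hν.1.symm
    simp [multiDeriv_const, hν0]
  · simp

/-! ### Periodic grids of bumps -/

/-- The function on the torus with the bump `φ`, scaled by `1 / N` and by the height `h`, in the
cells of the regular grid of mesh `1 / N` that `σ` selects. -/
noncomputable def torusGrid {d N : ℕ} (h : ℝ) (φ : (𝔼 d) → ℝ) (σ : (Fin d → ZMod N) → Bool) :
    UnitAddTorus (Fin d) → ℝ :=
  fun u => h * gridSum (fun z => if σ (fun i => (z i : ZMod N)) then 1 else 0) φ
    ((N : ℝ) • WithLp.toLp 2 fun i => (AddCircle.equivIco 1 0 (u i) : ℝ))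

section torusGrid

variable {d N : ℕ} {h : ℝ} {φ : (𝔼 d) → ℝ} {σ : (Fin d → ZMod N) → Bool}

/-- Replacing `t` by its fractional part shifts `N * t` by a multiple of `N`, which neither the
fractional part nor the class of the floor in `ZMod N` detects. -/
theorem torusLift_torusGrid : torusLift (torusGrid h φ σ) = fun x =>
    h * gridSum (fun z => if σ (fun i => (z i : ZMod N)) then 1 else 0) φ ((N : ℝ) • x) := by
  funext x
  have hN : ∀ t : ℝ, (N : ℝ) * Int.fract t = N * t - ((N * ⌊t⌋ : ℤ) : ℝ) := by
    intro t
    rw [Int.fract]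
    push_cast
    ring
  simp only [torusLift, torusGrid, gridSum, AddCircle.coe_equivIco_mk_apply, PiLp.smul_apply,
    smul_eq_mul, div_one, mul_one, hN, Int.floor_sub_intCast, Int.fract_sub_intCast]
  simp only [Int.cast_sub, Int.cast_mul, Int.cast_natCast, CharP.cast_eq_zero, zero_mul, sub_zero]
  congr!

theorem abs_ite_le_one (b : Bool) : |(if b then 1 else 0 : ℝ)| ≤ 1 := by
  cases b <;> simp

theorem contDiff_torusLift_torusGrid (hφ : IsCubeBump φ) (n : ℕ) :
    ContDiff ℝ n (torusLift (torusGrid h φ σ)) := by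
  rw [torusLift_torusGrid]
  exact contDiff_const.mul
    ((contDiff_gridSum (fun _ => abs_ite_le_one _) hφ n).comp (contDiff_const_smul _))

theorem multiDeriv_torusGrid (hφ : IsCubeBump φ) (ν : Fin d → ℕ) :
    multiDeriv ν (torusLift (torusGrid h φ σ)) = fun x => h * (N : ℝ) ^ (∑ i, ν i) *
      gridSum (fun z => if σ (fun i => (z i : ZMod N)) then 1 else 0) (multiDeriv ν φ)
        ((N : ℝ) • x) := by
  rw [torusLift_torusGrid, multiDeriv_comp_smul,
    multiDeriv_gridSum (fun _ => abs_ite_le_one _) hφ]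

theorem le_supDist_torusGrid (hN : 0 < N) (hh : 0 ≤ h) (hφ : IsCubeBump φ)
    (hc : φ (WithLp.toLp 2 fun _ => 1 / 2) = 1) {σ τ : (Fin d → ZMod N) → Bool} (hne : σ ≠ τ) :
    ENNReal.ofReal h ≤ supDist (torusGrid h φ σ) (torusGrid h φ τ) := by
  obtain ⟨j, hj⟩ := Function.ne_iff.1 hne
  have hN' : (N : ℝ) ≠ 0 := by exact_mod_cast hN.ne'
  have hfl : ∀ n : ℤ, ⌊(n + 1 / 2 : ℝ)⌋ = n := fun n => by
    rw [Int.floor_eq_iff]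
    constructor <;> linarith
  have hfr : ∀ n : ℤ, Int.fract (n + 1 / 2 : ℝ) = 1 / 2 := fun n => by
    rw [Int.fract, hfl]
    ring
  -- The sample point is the centre of the cell `j`, where the selections differ.
  have hval : ∀ ρ : (Fin d → ZMod N) → Bool, torusLift (torusGrid h φ ρ)
      (WithLp.toLp 2 fun i => ((ZMod.cast (j i) : ℤ) + 1 / 2 : ℝ) / N) =
        h * if ρ j then 1 else 0 := by
    intro ρ
    simp only [torusLift_torusGrid, gridSum, PiLp.smul_apply, smul_eq_mul,
      mul_div_cancel₀ _ hN', hfl, hfr, hc, ZMod.intCast_zmod_cast, mul_one]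
  refine le_trans (le_of_eq ?_) (ofReal_abs_torusLift_sub_le_supDist
    (contDiff_torusLift_torusGrid hφ 0).continuous (contDiff_torusLift_torusGrid hφ 0).continuous
    (WithLp.toLp 2 fun i => ((ZMod.cast (j i) : ℤ) + 1 / 2 : ℝ) / N))
  rw [hval, hval]
  congr 1
  cases hs : σ j <;> cases ht : τ j <;> simp_all [abs_of_nonneg]

theorem pow_le_rpow_of_le_floor {η : ℝ} (hη : 0 < η) (hN : 0 < N) {j : ℕ} (hj : j ≤ ⌊η⌋₊) :
    (N : ℝ) ^ j ≤ (N : ℝ) ^ η := by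
  rw [← Real.rpow_natCast]
  refine Real.rpow_le_rpow_of_exponent_le (by exact_mod_cast hN) ?_
  exact (Nat.le_floor_iff hη.le).1 hj

theorem abs_multiDeriv_torusGrid_le {η : ℝ} (hη : 0 < η) (hN : 0 < N) (hh : 0 ≤ h)
    (hφ : IsCubeBump φ) {ν : Fin d → ℕ} (hν : ∑ i, ν i ≤ ⌊η⌋₊) {M : ℝ}
    (hM : ∀ x, 2 * |multiDeriv ν φ x| ≤ M) (x : 𝔼 d) :
    |multiDeriv ν (torusLift (torusGrid h φ σ)) x| ≤ h * (N : ℝ) ^ η * M := by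
  have hM' : ∀ x, |multiDeriv ν φ x| ≤ M := fun x =>
    le_trans (by linarith [abs_nonneg (multiDeriv ν φ x)]) (hM x)
  have hp := pow_le_rpow_of_le_floor hη hN hν
  simp only [multiDeriv_torusGrid hφ]
  rw [abs_mul, abs_of_nonneg (by positivity : 0 ≤ h * (N : ℝ) ^ (∑ i, ν i))]
  gcongr
  exact abs_gridSum_le (fun _ => abs_ite_le_one _) hM' _

theorem min_one_mul_le {s t R : ℝ} (hs : 0 ≤ s) (hs1 : s ≤ 1) (ht : 0 < t) (hR : 1 ≤ R) :
    min 1 (R * t) ≤ R ^ s * min 1 (t ^ s) := by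
  have hRs : 1 ≤ R ^ s := Real.one_le_rpow hR hs
  have hRt : 0 < R * t := by positivity
  rcases le_total 1 (t ^ s) with h | h
  · rw [min_eq_left h, mul_one]
    exact (min_le_left _ _).trans hRs
  · rw [min_eq_right h, ← Real.mul_rpow (by linarith) ht.le]
    rcases le_total 1 (R * t) with h1 | h1
    · rw [min_eq_left h1]
      exact Real.one_le_rpow h1 hs
    · rw [min_eq_right h1]
      calc R * t = (R * t) ^ (1 : ℝ) := (Real.rpow_one _).symm
        _ ≤ (R * t) ^ s := Real.rpow_le_rpow_of_exponent_ge hRt h1 hs1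

/-- The `⌊η⌋₊` derivatives cost `N ^ ⌊η⌋₊`. Boundedness and the Lipschitz bound give `min 1 (N * ‖x
- y‖)`, and passing to the Hölder weight by `min_one_mul_le` costs the remaining `N ^ (η - ⌊η⌋₊)`.
-/
theorem holderSeminorm_multiDeriv_torusGrid_le {η : ℝ} (hη : 0 < η) (hN : 0 < N) (hh : 0 ≤ h)
    (hφ : IsCubeBump φ) {ν : Fin d → ℕ} (hν : ∑ i, ν i = ⌊η⌋₊) {M : ℝ} (hM0 : 0 ≤ M)
    (hM : ∀ x, 2 * |multiDeriv ν φ x| ≤ M) (hM' : ∀ x, ‖fderiv ℝ (multiDeriv ν φ) x‖ ≤ M) :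
    holderSeminorm (η - ⌊η⌋₊) (multiDeriv ν (torusLift (torusGrid h φ σ))) ≤
      ENNReal.ofReal (h * (N : ℝ) ^ η * M) := by
  refine iSup_le fun x => iSup_le fun y => iSup_le fun hxy => ENNReal.ofReal_le_ofReal ?_
  have hr : 0 < ‖x - y‖ := norm_pos_iff.2 (sub_ne_zero.2 hxy)
  have hs : 0 ≤ η - ⌊η⌋₊ := sub_nonneg.2 (Nat.floor_le hη.le)
  have hs1 : η - ⌊η⌋₊ ≤ 1 := by linarith [Nat.lt_floor_add_one η]
  have hN1 : (1 : ℝ) ≤ N := by exact_mod_cast hN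
  have hN0 : (0 : ℝ) < N := by linarith
  rw [div_le_iff₀ (lt_min one_pos (Real.rpow_pos_of_pos hr _))]
  simp only [multiDeriv_torusGrid hφ]
  set a : (Fin d → ℤ) → ℝ := fun z => if σ (fun i => (z i : ZMod N)) then 1 else 0
  have ha : ∀ z, |a z| ≤ 1 := fun _ => abs_ite_le_one _
  rw [← mul_sub, abs_mul, abs_of_nonneg (by positivity : 0 ≤ h * (N : ℝ) ^ (∑ i, ν i)), hν]
  have h1 : |gridSum a (multiDeriv ν φ) ((N : ℝ) • x) - gridSum a (multiDeriv ν φ) ((N : ℝ) • y)| ≤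
      M * min 1 (N * ‖x - y‖) := by
    rw [mul_min_of_nonneg _ _ hM0, mul_one]
    refine le_min ?_ ?_
    · have hb := abs_gridSum_le ha (φ := multiDeriv ν φ) (M := M / 2)
        (fun x => by linarith [hM x])
      refine (abs_sub _ _).trans ?_
      linarith [hb ((N : ℝ) • x), hb ((N : ℝ) • y)]
    · refine (abs_gridSum_sub_le ha (hφ.multiDeriv ν) hM' _ _).trans (le_of_eq ?_)
      rw [← smul_sub, norm_smul, Real.norm_of_nonneg hN0.le]
  have hsplit : (N : ℝ) ^ η = (N : ℝ) ^ ⌊η⌋₊ * (N : ℝ) ^ (η - ⌊η⌋₊) := by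
    rw [← Real.rpow_natCast, ← Real.rpow_add hN0]
    congr 1
    ring
  calc _ ≤ h * (N : ℝ) ^ ⌊η⌋₊ * (M * ((N : ℝ) ^ (η - ⌊η⌋₊) * min 1 (‖x - y‖ ^ (η - ⌊η⌋₊)))) := by
        gcongr
        exact h1.trans (by gcongr; exact min_one_mul_le hs hs1 hr hN1)
    _ = _ := by rw [hsplit]; ring

end torusGrid

/-- The Hölder norms of all grids of bumps are bounded by a common multiple of `h * N ^ η`. -/
theorem exists_torusHolderNorm_torusGrid_le {d : ℕ} {η : ℝ} (hη : 0 < η) {φ : (𝔼 d) → ℝ}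
    (hφ : IsCubeBump φ) : ∃ B : ℝ, 0 < B ∧ ∀ (N : ℕ) (h : ℝ) (σ : (Fin d → ZMod N) → Bool),
      0 < N → 0 ≤ h → torusHolderNorm η (torusGrid h φ σ) ≤
        ENNReal.ofReal (h * (N : ℝ) ^ η * B) := by
  choose M hM0 hM hM' using fun ν : Fin d → ℕ => (hφ.multiDeriv ν).exists_bound
  have hB1 : 0 ≤ ∑ j ∈ Finset.range (⌊η⌋₊ + 1),
      ∑ ν ∈ Finset.piAntidiag (Finset.univ : Finset (Fin d)) j, M ν :=
    Finset.sum_nonneg fun _ _ => Finset.sum_nonneg fun _ _ => hM0 _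
  have hB2 : 0 ≤ ∑ ν ∈ Finset.piAntidiag (Finset.univ : Finset (Fin d)) ⌊η⌋₊, M ν :=
    Finset.sum_nonneg fun _ _ => hM0 _
  -- The added `1` only makes `B` positive.
  refine ⟨_, add_pos_of_nonneg_of_pos (add_nonneg hB1 hB2) one_pos, fun N h σ hN hh => ?_⟩
  set K := h * (N : ℝ) ^ η
  have hK : 0 ≤ K := by positivity
  refine le_trans ?_ (ENNReal.ofReal_le_ofReal
    (mul_le_mul_of_nonneg_left (le_add_of_nonneg_right zero_le_one) hK))
  rw [mul_add, ENNReal.ofReal_add (mul_nonneg hK hB1) (mul_nonneg hK hB2), torusHolderNorm]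
  simp only [Finset.mul_sum]
  rw [ENNReal.ofReal_sum_of_nonneg
      fun _ _ => Finset.sum_nonneg fun _ _ => mul_nonneg hK (hM0 _),
    ENNReal.ofReal_sum_of_nonneg fun _ _ => mul_nonneg hK (hM0 _)]
  refine add_le_add (Finset.sum_le_sum fun j hj => ?_) (Finset.sum_le_sum fun ν hν => ?_)
  · rw [ENNReal.ofReal_sum_of_nonneg fun _ _ => mul_nonneg hK (hM0 _)]
    refine Finset.sum_le_sum fun ν hν => iSup_le fun x => ENNReal.ofReal_le_ofReal ?_
    refine abs_multiDeriv_torusGrid_le hη hN hh hφ ?_ (hM ν) x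
    rw [(Finset.mem_piAntidiag.1 hν).1]
    exact Nat.lt_succ_iff.1 (Finset.mem_range.1 hj)
  · exact holderSeminorm_multiDeriv_torusGrid_le hη hN hh hφ (Finset.mem_piAntidiag.1 hν).1
      (hM0 ν) (hM ν) (hM' ν)

/-! ### Choice of the mesh and the lower bound -/

theorem mainTheorem9 (d : ℕ) (hd : 1 ≤ d) (η : ℝ) (hη : 0 < η) :
    ∃ C : ℝ, 0 < C ∧
      ∀ ε : ℝ, 0 < ε → ε ≤ 3 / 4 →
        ∀ F : Set (TorusL2 d),
          (⨆ f ∈ torusHolderBall d η 1, ⨅ g ∈ F, supDist f g) ≤ ENNReal.ofReal ε →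
          ∀ θ : ℝ, 0 < θ → θ < ε / 3 →
            ((C * ε ^ (-((d : ℝ) / η)) : ℝ) : EReal) ≤
              ENNReal.log ((supCoveringNumber F θ : ℕ∞) : ℝ≥0∞) := by
  obtain ⟨φ, hφ, hφ1⟩ := exists_isCubeBump d
  obtain ⟨B, hB, hnorm⟩ := exists_torusHolderNorm_torusGrid_le hη hφ
  have hlog : 0 < Real.log 2 := Real.log_pos one_lt_two
  -- At `ε = ε₀` the norm bound for `N = 1` and height `8/3 * ε` is exactly `1`.
  obtain ⟨ε₀, hε₀, hε₀B⟩ : ∃ ε₀ : ℝ, 0 < ε₀ ∧ ε₀ * (8 / 3 * B) = 1 :=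
    ⟨(8 / 3 * B)⁻¹, by positivity, inv_mul_cancel₀ (by positivity)⟩
  refine ⟨Real.log 2 * (1 / 2) ^ d * ε₀ ^ ((d : ℝ) / η), by positivity, ?_⟩
  intro ε hε hε1 F hF θ hθ hθε
  have hscale : Real.log 2 * (1 / 2) ^ d * ε₀ ^ ((d : ℝ) / η) * ε ^ (-((d : ℝ) / η)) =
      Real.log 2 * ((ε₀ / ε) ^ (1 / η) / 2) ^ d := by
    rw [Real.rpow_neg hε.le, div_pow, div_pow, ← Real.rpow_natCast ((ε₀ / ε) ^ (1 / η)),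
      ← Real.rpow_mul (by positivity), Real.div_rpow hε₀.le hε.le, one_div_mul_eq_div, one_pow]
    ring
  rw [hscale]
  rcases le_or_gt ε ε₀ with hle | hgt
  · have ht1 : 1 ≤ (ε₀ / ε) ^ (1 / η) :=
      Real.one_le_rpow ((one_le_div hε).2 hle) (by positivity)
    set t := (ε₀ / ε) ^ (1 / η) with ht
    -- The largest `N` with `N ^ η ≤ ε₀ / ε`; as `t ≥ 1`, rounding down loses at most a factor `2`.
    set N := ⌊t⌋₊ with hNdef
    have hN : 0 < N := Nat.floor_pos.2 ht1
    have hN1 : (1 : ℝ) ≤ N := by exact_mod_cast hN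
    have hNt : (N : ℝ) ≤ t := Nat.floor_le (by linarith)
    have htN : t / 2 ≤ N := by linarith [Nat.lt_floor_add_one t]
    have hNη : (N : ℝ) ^ η ≤ ε₀ / ε := by
      calc (N : ℝ) ^ η ≤ t ^ η := Real.rpow_le_rpow (by linarith) hNt hη.le
        _ = ε₀ / ε := by
          rw [ht, ← Real.rpow_mul (by positivity), one_div_mul_cancel hη.ne', Real.rpow_one]
    have : NeZero N := ⟨hN.ne'⟩
    have hball : ∀ σ : (Fin d → ZMod N) → Bool,
        torusGrid (8 / 3 * ε) φ σ ∈ torusHolderBall d η 1 := by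
      intro σ
      refine ⟨contDiff_torusLift_torusGrid hφ _, (hnorm N _ σ hN (by positivity)).trans
        (ENNReal.ofReal_le_ofReal ?_)⟩
      calc 8 / 3 * ε * (N : ℝ) ^ η * B ≤ 8 / 3 * ε * (ε₀ / ε) * B := by gcongr
        _ = ε₀ * (8 / 3 * B) := by field_simp
        _ = 1 := hε₀B
    have hcard := card_le_supCoveringNumber hball hε hθ (r := 8 / 3 * ε) (by linarith)
      (fun σ τ hne => le_supDist_torusGrid hN (by positivity) hφ hφ1 hne) hF
    refine le_trans ?_ (log_card_le_log_supCoveringNumber Fintype.card_pos hcard)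
    rw [EReal.coe_le_coe_iff]
    simp only [Fintype.card_fun, Fintype.card_bool, ZMod.card, Fintype.card_fin, Nat.cast_pow,
      Nat.cast_ofNat, Real.log_pow]
    rw [mul_comm]
    gcongr
  -- Here `ε ≤ 3/4` enters: `2ε + 2θ < 8/3 * ε ≤ 2`, the distance between the constants. The bound
  -- `log 2` suffices because `ε₀ / ε < 1`.
  · have hcard := card_le_supCoveringNumber (H := torusHolderBall d η 1) (ι := Bool)
      (f := fun b _ => if b then 1 else -1) (r := 2)
      (fun b => const_mem_torusHolderBall d η (by cases b <;> simp)) hε hθ (by linarith)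
      (fun b b' hne => by
        refine le_trans (le_of_eq ?_) (ofReal_abs_torusLift_sub_le_supDist continuous_const
          continuous_const 0)
        cases b <;> cases b' <;> first | exact absurd rfl hne | norm_num [torusLift]) hF
    refine le_trans ?_ (log_card_le_log_supCoveringNumber Fintype.card_pos hcard)
    rw [EReal.coe_le_coe_iff, Fintype.card_bool]
    push_cast
    refine mul_le_of_le_one_right hlog.le (pow_le_one₀ (by positivity) ?_)
    have : (ε₀ / ε) ^ (1 / η) ≤ 1 :=
      Real.rpow_le_one (by positivity) ((div_le_one hε).2 hgt.le) (by positivity)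
    linarith
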